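/- All topological spaces are assumed to be Hausdorff. A perfect map is a continuous, closed, surjective map all of whose fibers are compact, and a perfect homomorphism is a group homomorphism that is a perfect map. A topological group $G$ is called - $Pm$-factorizable if for every continuous map $f\colon G\to M$ to a metrizable space $M$ there exist a perfect homomorphism $\pi\colon G\to K$ onto a second-countable topological group $K$ and a continuous map $g\colon K\to M$ with $f=g\circ\pi$; - $P\mathbb{R}$-factorizable if for every continuous function $f\colon G\to\mathbb{R}$ there exist a perfect homomorphism $\pi\colon G\to H$ onto a second-countable topological group $H$ and a continuous function $g\colon H\to\mathbb{R}$ with $f=g\circ\pi$. A space $X$ is pseudo-$\aleph_1$-compact if every discrete family of open subsets of $X$ is countable, where a family of subsets is discrete if every point of $X$ has a neighbourhood meeting at most one member of the family. **Theorem.** A topological group $G$ is $Pm$-factorizable if and only if $G$ is $P\mathbb{R}$-factorizable and pseudo-$\aleph_1$-compact. -/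

import Mathlib

universe u v

/-- A perfect map between topological spaces: a continuous closed map which is onto and
all of whose fibers are compact. -/
def IsPerfectMap {X Y : Type*} [TopologicalSpace X] [TopologicalSpace Y] (f : X → Y) : Prop :=
  Continuous f ∧ IsClosedMap f ∧ Function.Surjective f ∧ ∀ y : Y, IsCompact (f ⁻¹' {y})

/-- A family of subsets of a space is discrete if every point has a neighbourhood that meets
at most one member of the family. -/
def IsDiscreteFamily {X : Type*} [TopologicalSpace X] (F : Set (Set X)) : Prop :=
  ∀ x : X, ∃ U ∈ nhds x, {A | A ∈ F ∧ (A ∩ U).Nonempty}.Subsingleton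

/-- A space is pseudo-`ℵ₁`-compact if every discrete family of open subsets is countable. -/
def IsPseudoAlephOneCompact (X : Type*) [TopologicalSpace X] : Prop :=
  ∀ F : Set (Set X), (∀ A ∈ F, IsOpen A) → IsDiscreteFamily F → F.Countable

/-- `G` is `Pℝ`-factorizable: every continuous real-valued function on `G` is of the form `g ∘ π`
for a perfect homomorphism `π` onto a second-countable (Hausdorff) topological group `H` and a
continuous function `g : H → ℝ`. As `π` is onto, taking `H` in the universe of `G` is no
restriction. -/
def IsPRFactorizable (G : Type u) [TopologicalSpace G] [Group G] : Prop :=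
  ∀ f : G → ℝ, Continuous f →
    ∃ (H : Type u) (_ : TopologicalSpace H) (_ : Group H) (_ : IsTopologicalGroup H)
      (_ : T2Space H) (_ : SecondCountableTopology H) (π : G →* H) (g : H → ℝ),
      IsPerfectMap π ∧ Continuous g ∧ f = g ∘ π

/-- `G` is `Pm`-factorizable: every continuous map from `G` to a metrizable space `M` is of the form
`g ∘ π` for a perfect homomorphism `π` onto a second-countable (Hausdorff) topological group `K`
and a continuous map `g : K → M`. The space `M` may live in any universe. -/
def IsPmFactorizable (G : Type u) [TopologicalSpace G] [Group G] : Prop :=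
  ∀ (M : Type v) [TopologicalSpace M] [TopologicalSpace.MetrizableSpace M] (f : G → M),
    Continuous f →
    ∃ (K : Type u) (_ : TopologicalSpace K) (_ : Group K) (_ : IsTopologicalGroup K)
      (_ : T2Space K) (_ : SecondCountableTopology K) (π : G →* K) (g : K → M),
      IsPerfectMap π ∧ Continuous g ∧ f = g ∘ π

open Set Filter Topology

/-! Factoring a constant function shows that a `Pℝ`-factorizable group is Lindelöf, so
pseudo-`ℵ₁`-compactness is automatic. It remains to pass from real functions to a metrizable target:
`f` has separable image, so countably many distance functions `dist (f ·) (f t)` determine it. The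
diagonal of the perfect homomorphisms factoring them is perfect onto a second-countable group, and
`f` descends along it because perfect maps are quotient maps. -/

theorem IsPerfectMap.isProperMap {X Y : Type*} [TopologicalSpace X] [TopologicalSpace Y]
    {f : X → Y} (hf : IsPerfectMap f) : IsProperMap f :=
  isProperMap_iff_isClosedMap_and_compact_fibers.2 ⟨hf.1, hf.2.1, fun {y} => hf.2.2.2 y⟩

theorem IsProperMap.isPerfectMap {X Y : Type*} [TopologicalSpace X] [TopologicalSpace Y]
    {f : X → Y} (hf : IsProperMap f) (hs : Function.Surjective f) : IsPerfectMap f :=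
  ⟨hf.continuous, hf.isClosedMap, hs, fun _ => hf.isCompact_preimage isCompact_singleton⟩

theorem IsPerfectMap.isQuotientMap {X Y : Type*} [TopologicalSpace X] [TopologicalSpace Y]
    {f : X → Y} (hf : IsPerfectMap f) : IsQuotientMap f :=
  hf.2.1.isQuotientMap hf.1 hf.2.2.1

/-- The Lindelöf property is inherited by the domain of a proper map. -/
theorem IsProperMap.lindelofSpace {X Y : Type*} [TopologicalSpace X] [TopologicalSpace Y]
    [LindelofSpace Y] {f : X → Y} (hf : IsProperMap f) : LindelofSpace X := by
  refine ⟨isLindelof_of_countable_subcover fun {ι} U hUo hU => ?_⟩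
  have hfiber (y : Y) : ∃ t : Finset ι, f ⁻¹' {y} ⊆ ⋃ i ∈ t, U i :=
    (hf.isCompact_preimage isCompact_singleton).elim_finite_subcover U hUo
      ((subset_univ _).trans hU)
  choose t ht using hfiber
  have hnhds (y : Y) : {z | f ⁻¹' {z} ⊆ ⋃ i ∈ t y, U i} ∈ 𝓝 y := by
    have hopen : IsOpen (⋃ i ∈ t y, U i) := isOpen_biUnion fun i _ => hUo i
    -- Closedness of `f` makes this set of points, whose whole fiber lies in the finite union, open.
    have hV : (f '' (⋃ i ∈ t y, U i)ᶜ)ᶜ ∈ 𝓝 y := by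
      refine (hf.isClosedMap _ hopen.isClosed_compl).isOpen_compl.mem_nhds ?_
      rintro ⟨x, hx, hxy⟩
      exact hx (ht y hxy)
    filter_upwards [hV] with z hz x hx
    by_contra hxU
    exact hz ⟨x, hxU, hx⟩
  obtain ⟨s, hs, hsU⟩ := countable_cover_nhds hnhds
  refine ⟨⋃ y ∈ s, (t y : Set ι), hs.biUnion fun y _ => (t y).countable_toSet, fun x _ => ?_⟩
  have hx : f x ∈ ⋃ y ∈ s, {z | f ⁻¹' {z} ⊆ ⋃ i ∈ t y, U i} := hsU ▸ mem_univ _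
  obtain ⟨y, hy, hyx⟩ := mem_iUnion₂.1 hx
  obtain ⟨i, hi, hxi⟩ := mem_iUnion₂.1 (hyx rfl : x ∈ _)
  exact mem_iUnion₂.2 ⟨i, mem_iUnion₂.2 ⟨y, hy, hi⟩, hxi⟩

theorem IsDiscreteFamily.countable {X : Type*} [TopologicalSpace X] [LindelofSpace X]
    {F : Set (Set X)} (hF : IsDiscreteFamily F) : F.Countable := by
  choose U hU hsub using hF
  obtain ⟨s, hs, hsU⟩ := countable_cover_nhds hU
  -- The empty set may belong to `F` but meets no `U x`.
  have hcount : (insert ∅ (⋃ x ∈ s, {A | A ∈ F ∧ (A ∩ U x).Nonempty})).Countable :=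
    (hs.biUnion fun x _ => (hsub x).countable).insert _
  refine hcount.mono fun A hA => ?_
  rcases A.eq_empty_or_nonempty with rfl | ⟨a, ha⟩
  · exact mem_insert _ _
  · have ha' : a ∈ ⋃ x ∈ s, U x := hsU ▸ mem_univ _
    obtain ⟨x, hx, hax⟩ := mem_iUnion₂.1 ha'
    exact mem_insert_of_mem _ (mem_iUnion₂.2 ⟨x, hx, hA, a, ha, hax⟩)

theorem LindelofSpace.isPseudoAlephOneCompact (X : Type*) [TopologicalSpace X] [LindelofSpace X] :
    IsPseudoAlephOneCompact X :=
  fun _ _ hF => hF.countable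

/-- A `Pℝ`-factorizable group is a perfect preimage of a second-countable space, hence Lindelöf. -/
theorem IsPRFactorizable.lindelofSpace {G : Type u} [TopologicalSpace G] [Group G]
    (hG : IsPRFactorizable.{u} G) : LindelofSpace G := by
  obtain ⟨H, _, _, _, _, _, π, _, hπ, -⟩ := hG (fun _ => 0) continuous_const
  exact hπ.isProperMap.lindelofSpace

theorem IsPmFactorizable.isPRFactorizable {G : Type u} [TopologicalSpace G] [Group G]
    (hG : IsPmFactorizable.{u, v} G) : IsPRFactorizable.{u} G := by
  intro f hf
  -- Targets live in universe `v`, so `ℝ` is lifted there.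
  have : TopologicalSpace.MetrizableSpace (ULift.{v} ℝ) :=
    Homeomorph.ulift.isEmbedding.metrizableSpace
  obtain ⟨K, _, _, _, _, _, π, g, hπ, hg, hfg⟩ :=
    hG (ULift.{v} ℝ) (ULift.up ∘ f) (continuous_uliftUp.comp hf)
  have hfg' : f = (ULift.down ∘ g) ∘ π := by rw [Function.comp_assoc, ← hfg]; rfl
  exact ⟨K, _, ‹_›, ‹_›, ‹_›, ‹_›, π, ULift.down ∘ g, hπ, continuous_uliftDown.comp hg, hfg'⟩

/-- A continuous image of a Lindelöf space in a metric space has a countable dense subset. -/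
theorem Continuous.exists_countable_forall_dist_lt {X M : Type*} [TopologicalSpace X]
    [LindelofSpace X] [PseudoMetricSpace M] {f : X → M} (hf : Continuous f) :
    ∃ T : Set X, T.Countable ∧ ∀ ε > 0, ∀ x, ∃ t ∈ T, dist (f x) (f t) < ε := by
  have hcover (n : ℕ) : ∃ s : Set X, s.Countable ∧
      ⋃ x ∈ s, f ⁻¹' Metric.ball (f x) (1 / (n + 1)) = univ :=
    countable_cover_nhds fun x =>
      hf.continuousAt.preimage_mem_nhds (Metric.ball_mem_nhds _ Nat.one_div_pos_of_nat)
  choose s hs hsU using hcover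
  refine ⟨⋃ n, s n, countable_iUnion hs, fun ε hε x => ?_⟩
  obtain ⟨n, hn⟩ := exists_nat_one_div_lt hε
  have hx : x ∈ ⋃ t ∈ s n, f ⁻¹' Metric.ball (f t) (1 / (n + 1)) := hsU n ▸ mem_univ _
  obtain ⟨t, ht, hxt⟩ := mem_iUnion₂.1 hx
  exact ⟨t, mem_iUnion.2 ⟨n, ht⟩, (Metric.mem_ball.1 hxt).trans hn⟩

/-- The diagonal of a nonempty family of perfect homomorphisms into Hausdorff groups is perfect
onto its image. -/
theorem MonoidHom.isPerfectMap_rangeRestrict_pi {G ι : Type*} [TopologicalSpace G] [Group G]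
    [Nonempty ι] {H : ι → Type*} [∀ i, TopologicalSpace (H i)] [∀ i, Group (H i)]
    [∀ i, T2Space (H i)] (π : ∀ i, G →* H i) (hπ : ∀ i, IsPerfectMap (π i)) :
    IsPerfectMap (MonoidHom.pi π).rangeRestrict := by
  obtain ⟨i⟩ := ‹Nonempty ι›
  have hcont : Continuous (MonoidHom.pi π).rangeRestrict :=
    (continuous_pi fun j => (hπ j).1).subtype_mk _
  refine IsProperMap.isPerfectMap ?_ (MonoidHom.pi π).rangeRestrict_surjective
  -- Composing with a single coordinate gives back the proper map `π i`.
  exact isProperMap_of_comp_of_t2 hcont ((continuous_apply i).comp continuous_subtype_val)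
    (hπ i).isProperMap

theorem IsPRFactorizable.isPmFactorizable {G : Type u} [TopologicalSpace G] [Group G]
    (hG : IsPRFactorizable.{u} G) : IsPmFactorizable.{u, v} G := by
  intro M _ _ f hf
  let _ : MetricSpace M := TopologicalSpace.metrizableSpaceMetric M
  have : LindelofSpace G := hG.lindelofSpace
  obtain ⟨T, hT, hdense⟩ := hf.exists_countable_forall_dist_lt
  have : Countable T := hT.to_subtype
  have : Nonempty T := let ⟨t, ht, _⟩ := hdense 1 one_pos 1; ⟨⟨t, ht⟩⟩
  have hfac (t : T) := hG (fun x => dist (f x) (f t)) (hf.dist continuous_const)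
  choose H _ _ _ _ _ π g hπ hg hfg using hfac
  have hperf := MonoidHom.isPerfectMap_rangeRestrict_pi π hπ
  have hker (x y : G)
      (hxy : (MonoidHom.pi π).rangeRestrict x = (MonoidHom.pi π).rangeRestrict y) :
      f x = f y := by
    have hdist (t : T) : dist (f x) (f t) = dist (f y) (f t) := by
      have hπt : π t x = π t y := congrFun (congrArg Subtype.val hxy) t
      rw [show dist (f x) (f t) = g t (π t x) from congrFun (hfg t) x, hπt]
      exact (congrFun (hfg t) y).symm
    -- Some `f t` is within `ε / 2` of `f x`, hence equally close to `f y`.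
    refine eq_of_forall_dist_le fun ε hε => ?_
    obtain ⟨t, ht, hxt⟩ := hdense (ε / 2) (half_pos hε) x
    have hyt := hdist ⟨t, ht⟩ ▸ hxt
    linarith [dist_triangle_right (f x) (f y) (f t)]
  have hlift : f =
      (f ∘ Function.surjInv hperf.2.2.1) ∘ (MonoidHom.pi π).rangeRestrict :=
    funext fun x => hker _ _ (Function.surjInv_eq hperf.2.2.1 _).symm
  exact ⟨(MonoidHom.pi π).range, inferInstance, inferInstance, inferInstance, inferInstance,
    TopologicalSpace.Subtype.secondCountableTopology _, _, _, hperf, hperf.isQuotientMap.continuous_iff.2 (hlift ▸ hf), hlift⟩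

theorem theorem5p4 (G : Type u) [TopologicalSpace G] [Group G] [IsTopologicalGroup G]
    [T2Space G] :
    IsPmFactorizable.{u, v} G ↔ (IsPRFactorizable.{u} G ∧ IsPseudoAlephOneCompact G) := by
  refine ⟨fun h => ?_, fun h => h.1.isPmFactorizable⟩
  have : LindelofSpace G := h.isPRFactorizable.lindelofSpace
  exact ⟨h.isPRFactorizable, LindelofSpace.isPseudoAlephOneCompact G⟩
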